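/- There is a universal constant $C>0$ such that the following holds. Let $(\mathfrak B,\|\cdot\|)$ be a real Banach space that is $(2,\lambda)$-uniformly convex for some $\lambda>0$, i.e. $\tfrac12\|\cdot\|^2$ is $\lambda$-strongly convex with respect to $\|\cdot\|$. Let $L\ge 1$ and $n\ge 1$. Consider online convex optimization over $\mathfrak B$ for $n$ rounds against an adaptive adversary: in each round $t$ the adversary picks a convex function $f_t:\mathfrak B\to\mathbb R$ that is $L$-Lipschitz with respect to $\|\cdot\|$, possibly depending on all random draws of the learner before round $t$, and the learner then plays a random point $w_t$. The learner uses the following algorithm. *Sub-algorithms.* For $1\le i\le N:=n+1$ put $R_i=e^{i-1}$, $c_i=R_iL$, $\pi_i=1/(n+1)$ and let $(w_t^i)_{t\le n}$ be the iterates of Mirror Descent on the losses $\tilde f_t=f_t-f_t(0)$ with step size $\eta_i=\frac{R_i}{L}\sqrt{\lambda/n}$, feasible set $\mathcal W_i=\{w:\|w\|\le R_i\}$ and regularizer $\mathcal R=\tfrac12\|\cdot\|^2$ (or $\mathcal R=\|\cdot\|^2$): $w_1^i$ minimizes $\mathcal R$ over $\mathcal W_i$; with $g$ a subgradient of $\tilde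 f_t$ at $w_t^i$ and $\tilde w$ such that $\nabla\mathcal R(\tilde w)=\nabla\mathcal R(w_t^i)-\eta_i g$, the iterate $w_{t+1}^i$ minimizes the Bregman divergence $w\mapsto\mathcal R(w)-\mathcal R(\tilde w)-\langle\nabla\mathcal R(\tilde w),w-\tilde w\rangle$ over $\mathcal W_i$. If $\mathcal R$ is not differentiable, $\nabla\mathcal R$ stands for a subgradient; at the iterate $w_{t+1}^i$ it is one that satisfies the first-order optimality condition $\langle\nabla\mathcal R(w_{t+1}^i)-\nabla\mathcal R(\tilde w),u-w_{t+1}^i\rangle\ge0$ for all $u\in\mathcal W_i$ (and likewise at $w_1^i$, with $\langle\nabla\mathcal R(w_1^i),u-w_1^i\rangle\ge0$). *Aggregation.* In round $t$ the learner draws fresh independent uniform sign vectors $\sigma_{t+1},\dots,\sigma_n\in\{\pm1\}^N$, takes $p_t$ to be a minimizer over $p$ in the probability simplex $\Delta_N$ of $$\sup_{x\in\mathbb R^N:\,|x[i]|\le c_i\,\forall i}\Big[\langle p,x\rangle+\max_{i\le N}\Big(-\sum_{s<t}\tilde f_s(w_s^i)-x[i]+4\sum_{s=t+1}^n\sigma_s[i]c_i-5c_i\sqrt{n\log(4c_i^2n/\pi_i)}\Big)\Big],$$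 draws $i_t\sim p_t$ and plays $w_t=w_t^{i_t}$. Then, with expectation over the learner's draws, for every $w\in\mathfrak B$, $$\mathbb E\Big[\sum_{t=1}^n f_t(w_t)-\sum_{t=1}^n f_t(w)\Big]\le C\,L(\|w\|+1)\sqrt{\frac{n\log\big((\|w\|+1)Ln\big)}{\lambda}}.$$ Moreover, the comparator may depend on the realized draws: for every $\mathfrak B$-valued function $u$ of these draws, $$\mathbb E\Big[\sum_{t=1}^n f_t(w_t)-\sum_{t=1}^n f_t(u)-C\,L(\|u\|+1)\sqrt{\frac{n\log\big((\|u\|+1)Ln\big)}{\lambda}}\Big]\le0.$$ -/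

import Mathlib

open scoped NNReal

noncomputable section

/-! ### Convex analysis -/

/-- `φ` is a subgradient of `h` at `x`. -/
def IsSubgradientAt {E : Type*} [NormedAddCommGroup E] [NormedSpace ℝ E]
    (h : E → ℝ) (φ : StrongDual ℝ E) (x : E) : Prop :=
  ∀ y : E, h x + φ (y - x) ≤ h y

/-- The Bregman divergence `D_ℛ(u | v)`, where `θ` is the (sub)gradient of `ℛ` at `v`. -/
def bregman {E : Type*} [NormedAddCommGroup E] [NormedSpace ℝ E]
    (ℛ : E → ℝ) (θ : StrongDual ℝ E) (u v : E) : ℝ :=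
  ℛ u - ℛ v - θ (u - v)

/-- A `(2, lam)`-uniformly convex normed space: `½‖·‖²` is `lam`-strongly convex with respect
to the norm itself. -/
def IsTwoUniformlyConvex (E : Type*) [NormedAddCommGroup E] [NormedSpace ℝ E] (lam : ℝ) : Prop :=
  StrongConvexOn (Set.univ : Set E) lam (fun w => ‖w‖ ^ 2 / 2)

/-! ### Mirror Descent -/

/-- `w 0, …, w (n - 1)` are iterates of Mirror Descent with step size `η`, feasible set `W` and
regularizer `ℛ`, run on the losses `h 0, …, h (n - 1)`.

Here `g t` is the (sub)gradient of the loss `h t` at `w t`, and `φ t` plays the role of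
`∇ℛ (w t)`: it is a subgradient of `ℛ` at `w t` (so that `ℛ` need not be differentiable).
The point `v t` is the unprojected iterate that follows `w t`: `∇ℛ (v t) = ∇ℛ (w t) - η g t`, and
the next iterate minimizes the Bregman divergence to `v t` over `W`.

Wherever `ℛ` has several subgradients at an iterate, `φ` is the one that certifies the minimality
of that iterate (the variational inequalities below); if `ℛ` is differentiable, then
`φ t = ∇ℛ (w t)` is the only subgradient, and these inequalities hold automatically. -/
def IsMirrorDescent {E : Type*} [NormedAddCommGroup E] [NormedSpace ℝ E] {n : ℕ}
    (η : ℝ) (W : Set E) (ℛ : E → ℝ) (h : Fin n → E → ℝ) (w : Fin n → E) : Prop :=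
  ∃ (g φ : Fin n → StrongDual ℝ E) (v : Fin n → E),
    (∀ t, IsSubgradientAt (h t) (g t) (w t)) ∧
    (∀ t, IsSubgradientAt ℛ (φ t) (w t)) ∧
    (∀ t : Fin n, (t : ℕ) = 0 →
      w t ∈ W ∧ IsMinOn ℛ W (w t) ∧ ∀ u ∈ W, 0 ≤ φ t (u - w t)) ∧
    (∀ t t' : Fin n, (t' : ℕ) = t + 1 →
      IsSubgradientAt ℛ (φ t - η • g t) (v t) ∧
      w t' ∈ W ∧ IsMinOn (fun u => bregman ℛ (φ t - η • g t) u (v t)) W (w t') ∧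
      ∀ u ∈ W, 0 ≤ (φ t' - (φ t - η • g t)) (u - w t'))

/-! ### The probability space of the learner's randomization -/

/-- The sign vectors drawn in one round: `σ s i` for a round `s` and an expert `i`. In round `t`
only the `σ s` with `s > t` are used. -/
abbrev Playout (n N : ℕ) : Type := Fin n → Fin N → ℤˣ

/-- All random draws of the learner: in each round `t`, a fresh array of signs `(ω t).1` and the
index `(ω t).2` of the expert that is played. -/
abbrev Outcome (n N : ℕ) : Type := Fin n → Playout n N × Fin N

/-- `X t` is determined by the draws made strictly before round `t`. -/
def IsPredictable {n N : ℕ} {α : Type*} (X : Fin n → Outcome n N → α) : Prop :=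
  ∀ (t : Fin n) (ω ω' : Outcome n N), (∀ s < t, ω s = ω' s) → X t ω = X t ω'

/-- The probability of the outcome `ω`: in each round the signs are uniform and independent of the
past, and then the expert is drawn from the distribution `p t ω`. -/
def outcomeProb {n N : ℕ} (p : Fin n → Outcome n N → Fin N → ℝ) (ω : Outcome n N) : ℝ :=
  ∏ t, ((Fintype.card (Playout n N) : ℝ)⁻¹ * p t ω (ω t).2)

/-- Expectation over the learner's randomization. -/
def expect {n N : ℕ} (p : Fin n → Outcome n N → Fin N → ℝ) (X : Outcome n N → ℝ) : ℝ :=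
  ∑ ω, outcomeProb p ω * X ω

/-! ### The multi-scale experts algorithm -/

/-- `B(i) = 5 c_i √(n log (4 c_i² n / π_i))`. -/
def ftplPenalty {N : ℕ} (n : ℕ) (c π : Fin N → ℝ) (i : Fin N) : ℝ :=
  5 * c i * √(n * Real.log (4 * c i ^ 2 * n / π i))

/-- The objective that is minimized over `q` in the simplex in round `t`, given the earlier loss
vectors `g s`, `s < t`, and the signs `σ s`, `s > t`; the variable `x` is the loss vector of
round `t`. -/
def ftplObjective {n N : ℕ} (c π : Fin N → ℝ) (t : Fin n) (g : Fin n → Fin N → ℝ)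
    (σ : Playout n N) (q : Fin N → ℝ) : ℝ :=
  ⨆ x : {x : Fin N → ℝ // ∀ i, |x i| ≤ c i},
    (∑ i, q i * x.1 i +
      ⨆ i, (-(∑ s ∈ Finset.Iio t, g s i + x.1 i)
        + 4 * ∑ s ∈ Finset.Ioi t, ((σ s i : ℤ) : ℝ) * c i - ftplPenalty n c π i))

/-- `p t ω` are the distributions that MultiScaleFTPL with scales `c` and prior `π` computes on
the loss vectors `g t ω`: `p t ω` depends only on the draws before round `t` and on the signs of
round `t`, and it is a minimizer over the simplex. -/
structure IsMultiScaleFTPL {n N : ℕ} (c π : Fin N → ℝ) (g : Fin n → Outcome n N → Fin N → ℝ)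
    (p : Fin n → Outcome n N → Fin N → ℝ) : Prop where
  adapted : ∀ (t : Fin n) (ω ω' : Outcome n N),
    (∀ s < t, ω s = ω' s) → (ω t).1 = (ω' t).1 → p t ω = p t ω'
  mem_simplex : ∀ t ω, p t ω ∈ stdSimplex ℝ (Fin N)
  isMinOn : ∀ t ω,
    IsMinOn (ftplObjective c π t (fun s => g s ω) (ω t).1) (stdSimplex ℝ (Fin N)) (p t ω)

/-- `x i t ω` are the iterates of the sub-algorithms and `p t ω` the distributions of the
meta-algorithm in a run of MultiScaleOCO against the losses `f t ω`. The relation `Alg i h w` says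
that `w` is the sequence of iterates of the `i`-th sub-algorithm on the losses `h`. -/
structure IsMultiScaleOCO {E : Type*} [NormedAddCommGroup E] {n N : ℕ}
    (Alg : Fin N → (Fin n → E → ℝ) → (Fin n → E) → Prop) (R Lip π : Fin N → ℝ)
    (f : Fin n → Outcome n N → E → ℝ)
    (x : Fin N → Fin n → Outcome n N → E) (p : Fin n → Outcome n N → Fin N → ℝ) : Prop where
  predictable : ∀ i, IsPredictable (x i)
  sub : ∀ i ω, Alg i (fun t v => f t ω v - f t ω 0) (fun t => x i t ω)
  ftpl : IsMultiScaleFTPL (fun i => R i * Lip i) π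
    (fun t ω i => f t ω (x i t ω) - f t ω 0) p

/-- The configuration for a `(2, lam)`-uniformly convex space: `N = n + 1` instances of Mirror
Descent on the balls of radii `R_i = eⁱ`, `i = 0, …, n`, with step sizes `(R_i / L) √(lam / n)`,
and the uniform prior. -/
def IsParameterFreeRun {E : Type*} [NormedAddCommGroup E] [NormedSpace ℝ E] {n : ℕ}
    (lam L : ℝ) (ℛ : E → ℝ) (f : Fin n → Outcome n (n + 1) → E → ℝ)
    (x : Fin (n + 1) → Fin n → Outcome n (n + 1) → E)
    (p : Fin n → Outcome n (n + 1) → Fin (n + 1) → ℝ) : Prop :=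
  IsMultiScaleOCO
    (fun i => IsMirrorDescent (Real.exp (i : ℕ) / L * √(lam / n))
      {w : E | ‖w‖ ≤ Real.exp (i : ℕ)} ℛ)
    (fun i => Real.exp (i : ℕ)) (fun _ => L) (fun _ => 1 / ((n : ℝ) + 1)) f x p

/-- The regret `∑ f_t(w_t) - ∑ f_t(u)` on the outcome `ω`, where the point played in round `t` is
the iterate `w_t = w_t^{i_t}` of the drawn expert `i_t`. -/
def regret {E : Type*} {n N : ℕ} (f : Fin n → Outcome n N → E → ℝ)
    (x : Fin N → Fin n → Outcome n N → E) (ω : Outcome n N) (u : E) : ℝ :=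
  ∑ t, f t ω (x (ω t).2 t ω) - ∑ t, f t ω u

/-- `L (‖w‖ + 1) √(n log ((‖w‖ + 1) L n) / lam)`. -/
def oracleRate {E : Type*} [NormedAddCommGroup E] (n : ℕ) (lam L : ℝ) (w : E) : ℝ :=
  L * (‖w‖ + 1) * √(n * Real.log ((‖w‖ + 1) * L * n) / lam)

end

/-!
The regret of the learner splits into the regret of the aggregation against one expert and the
regret of that expert, an instance of Mirror Descent on the ball of radius `e ^ i`.

*Mirror Descent.* The variational inequality at each iterate gives the usual three-point identity,
and strong convexity bounds the divergence between consecutive iterates from below. Telescoping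
yields regret `2 R L √(n / lam)` against comparators in the ball of radius `R`
(`IsMirrorDescent.regret_ball_le`).

*Aggregation.* The potential `ftplPotential`, which is the loss so far plus the expectation over
random signs of `max_i` of the relaxed score, is a supermartingale under the law of the draws
(`ftplPotential_step`). This rests on a one-round inequality: for real `b` and positive `c` some `q`
in the simplex satisfies
`sup_x (⟨q, x⟩ + max_i (b i - x i)) ≤ 𝔼 max_i (b i + 4 ε i c i)`, the supremum being over
`|x i| ≤ c i` and `ε` a uniform sign vector. No minimax theorem is needed. The left side is at most
`∑ q i c i + max_i (b i + c i - 2 q i c i)`, and water filling produces a `q` for which the terms of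
this maximum agree on the support of `q` (`exists_waterFilling`), so that the value becomes
`∑ q i (b i + 2 (1 - q i) c i)`. The right side is at least the expected average of
`b i + 4 ε i c i` with the random weights `q i (1 + (ε i - ε̄) / 2)`, `ε̄ = ∑ q k ε k`, and this
expectation is the same number (`le_avg_iSup_signs`). Since the learner's distribution minimizes the
left side, it does at least as well as `q`.

The supermartingale starts at `𝔼 max_i (4 c i ∑ σ s i - B i)`, where `B` is the penalty; sub-Gaussian
tails make this at most `4 √n` (`avg_iSup_signs_sub_penalty_le`). It ends at the loss of the learner
minus the least penalized loss of an expert. The maximum over the experts sits inside the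
expectation, so the expert may be chosen after the draws, and hence so may the comparator.

*Choice of the expert.* For a comparator `u` some scale satisfies `e ^ i ≤ 3 (‖u‖ + 1)` and either
covers `u` or is beaten by the trivial Lipschitz bound, because then `log (‖u‖ + 1) ≥ n`
(`exists_scale`). For `n ≥ 2` the penalty, the regret of the expert and `4 √n` are all at most a
multiple of `oracleRate`; this uses `lam ≤ 1`, which holds in every nontrivial space. For `n = 1` all
iterates are `0` and the bound is checked directly.
-/

open scoped NNReal

noncomputable section

/-! ### Expectations over the learner's draws -/

/-- Resampling one coordinate uniformly does not change a sum over all functions: exchange the old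
and the new value of that coordinate. -/
theorem sum_pi_eq_sum_update {ι Z : Type*} [Fintype ι] [DecidableEq ι] [Fintype Z] [Nonempty Z]
    (F : (ι → Z) → ℝ) (k : ι) :
    ∑ ω, F ω = (Fintype.card Z : ℝ)⁻¹ * ∑ ω : ι → Z, ∑ z, F (Function.update ω k z) := by
  have hinv : Function.Involutive
      (fun a : (ι → Z) × Z => (Function.update a.1 k a.2, a.1 k)) := by
    rintro ⟨ω, z⟩; simp
  have h := Equiv.sum_comp hinv.toPerm (fun a : (ι → Z) × Z => F a.1)
  rw [Fintype.sum_prod_type, Fintype.sum_prod_type] at h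
  have hcard : (Fintype.card Z : ℝ) ≠ 0 := by simp
  simp only [Function.Involutive.coe_toPerm, Finset.sum_const, Finset.card_univ,
    nsmul_eq_mul] at h
  rw [h, ← Finset.mul_sum, inv_mul_cancel_left₀ hcard]

/-- The probability of the draws in round `t` given the earlier ones. -/
def drawProb {n N : ℕ} (p : Fin n → Outcome n N → Fin N → ℝ) (t : Fin n) (ω : Outcome n N) : ℝ :=
  (Fintype.card (Playout n N) : ℝ)⁻¹ * p t ω (ω t).2

/-- The law of the outcome when the draws of the rounds before `k` are those of the learner and all
later ones are uniform. It interpolates between the uniform law and `outcomeProb`. -/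
def partialProb {n N : ℕ} (p : Fin n → Outcome n N → Fin N → ℝ) (k : ℕ) (ω : Outcome n N) : ℝ :=
  ∏ t : Fin n, if (t : ℕ) < k then drawProb p t ω
    else (Fintype.card (Playout n N × Fin N) : ℝ)⁻¹

section Law

variable {n N : ℕ} {p : Fin n → Outcome n N → Fin N → ℝ}

theorem drawProb_nonneg (hp : ∀ t ω, p t ω ∈ stdSimplex ℝ (Fin N)) (t : Fin n)
    (ω : Outcome n N) : 0 ≤ drawProb p t ω :=
  mul_nonneg (by positivity) ((hp t ω).1 _)

theorem partialProb_nonneg (hp : ∀ t ω, p t ω ∈ stdSimplex ℝ (Fin N)) (k : ℕ)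
    (ω : Outcome n N) : 0 ≤ partialProb p k ω := by
  refine Finset.prod_nonneg fun t _ => ?_
  split_ifs
  · exact drawProb_nonneg hp t ω
  · positivity

theorem partialProb_eq_outcomeProb (ω : Outcome n N) : partialProb p n ω = outcomeProb p ω := by
  simp [partialProb, outcomeProb, drawProb]

theorem drawProb_update_of_lt
    (had : ∀ (t : Fin n) (ω ω' : Outcome n N),
      (∀ s < t, ω s = ω' s) → (ω t).1 = (ω' t).1 → p t ω = p t ω')
    {t k : Fin n} (htk : t < k) (ω : Outcome n N) (z : Playout n N × Fin N) :
    drawProb p t (Function.update ω k z) = drawProb p t ω := by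
  have h1 : ∀ s ≤ t, Function.update ω k z s = ω s := fun s hs =>
    Function.update_of_ne (hs.trans_lt htk).ne _ _
  rw [drawProb, drawProb, h1 t le_rfl,
    had t _ ω (fun s hs => h1 s hs.le) (by rw [h1 t le_rfl])]

/-- Conditioning on the draws before round `k`. Because the later draws are uniform under
`partialProb`, no assumption on the later behaviour of `X` is needed. -/
theorem sum_partialProb_succ_mul [NeZero N]
    (had : ∀ (t : Fin n) (ω ω' : Outcome n N),
      (∀ s < t, ω s = ω' s) → (ω t).1 = (ω' t).1 → p t ω = p t ω')
    (k : Fin n) (X : Outcome n N → ℝ) :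
    ∑ ω, partialProb p (k + 1) ω * X ω = ∑ ω, partialProb p k ω *
      ∑ z, drawProb p k (Function.update ω k z) * X (Function.update ω k z) := by
  rw [sum_pi_eq_sum_update _ k, Finset.mul_sum]
  refine Finset.sum_congr rfl fun ω _ => ?_
  rw [Finset.mul_sum, Finset.mul_sum]
  refine Finset.sum_congr rfl fun z _ => ?_
  have key : (Fintype.card (Playout n N × Fin N) : ℝ)⁻¹ *
      partialProb p (k + 1) (Function.update ω k z) =
      partialProb p k ω * drawProb p k (Function.update ω k z) := by
    rw [partialProb, partialProb, ← Finset.mul_prod_erase _ _ (Finset.mem_univ k),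
      ← Finset.mul_prod_erase _ _ (Finset.mem_univ k), if_pos (Nat.lt_succ_self _),
      if_neg (lt_irrefl _)]
    have : ∀ t ∈ Finset.univ.erase k,
        (if (t : ℕ) < (k : ℕ) + 1 then drawProb p t (Function.update ω k z)
          else (Fintype.card (Playout n N × Fin N) : ℝ)⁻¹) =
        (if (t : ℕ) < (k : ℕ) then drawProb p t ω
          else (Fintype.card (Playout n N × Fin N) : ℝ)⁻¹) := by
      intro t ht
      have hne : (t : ℕ) ≠ k := fun h => (Finset.ne_of_mem_erase ht) (Fin.ext h)
      by_cases h : (t : ℕ) < k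
      · rw [if_pos h, if_pos (by omega), drawProb_update_of_lt had h]
      · rw [if_neg h, if_neg (by omega)]
    rw [Finset.prod_congr rfl this]
    ring
  rw [← mul_assoc, key, mul_assoc]

/-- If `Φ` is a supermartingale started at the constant `V`, then its terminal expectation is at
most `V`. -/
theorem expect_le_of_supermartingale [NeZero N]
    (had : ∀ (t : Fin n) (ω ω' : Outcome n N),
      (∀ s < t, ω s = ω' s) → (ω t).1 = (ω' t).1 → p t ω = p t ω')
    (hp : ∀ t ω, p t ω ∈ stdSimplex ℝ (Fin N)) (Φ : ℕ → Outcome n N → ℝ) (V : ℝ)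
    (h0 : ∀ ω, Φ 0 ω ≤ V)
    (hstep : ∀ (k : Fin n) ω, ∑ z, drawProb p k (Function.update ω k z) *
      Φ (k + 1) (Function.update ω k z) ≤ Φ k ω) :
    expect p (Φ n) ≤ V := by
  have key : ∀ k ≤ n, ∑ ω, partialProb p k ω * Φ k ω ≤ V := by
    intro k
    induction k with
    | zero =>
      intro _
      refine (Finset.sum_le_sum fun ω _ => mul_le_mul_of_nonneg_left (h0 ω)
        (partialProb_nonneg hp 0 ω)).trans_eq ?_
      rw [← Finset.sum_mul]
      simp only [partialProb, Nat.not_lt_zero, if_false, Finset.prod_const, Finset.sum_const,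
        Finset.card_univ, Fintype.card_fin, nsmul_eq_mul]
      rw [Fintype.card_fun, Fintype.card_fin, Nat.cast_pow, ← mul_pow,
        mul_inv_cancel₀ (by simp [NeZero.ne]), one_pow, one_mul]
    | succ k ih =>
      intro hk
      refine le_trans ?_ (ih (by omega))
      rw [sum_partialProb_succ_mul had ⟨k, hk⟩]
      exact Finset.sum_le_sum fun ω _ => mul_le_mul_of_nonneg_left (hstep ⟨k, hk⟩ ω)
        (partialProb_nonneg hp k ω)
  simpa only [partialProb_eq_outcomeProb, expect] using key n le_rfl

theorem sum_drawProb_update_mul [NeZero N]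
    (had : ∀ (t : Fin n) (ω ω' : Outcome n N),
      (∀ s < t, ω s = ω' s) → (ω t).1 = (ω' t).1 → p t ω = p t ω')
    (k : Fin n) (ω : Outcome n N) (X : Fin N → ℝ) :
    ∑ z : Playout n N × Fin N, drawProb p k (Function.update ω k z) * X z.2 =
      (Fintype.card (Playout n N) : ℝ)⁻¹ *
        ∑ σ : Playout n N, ∑ i, p k (Function.update ω k (σ, 0)) i * X i := by
  rw [Fintype.sum_prod_type, Finset.mul_sum]
  refine Finset.sum_congr rfl fun σ _ => ?_
  rw [Finset.mul_sum]
  refine Finset.sum_congr rfl fun i _ => ?_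
  have : p k (Function.update ω k (σ, i)) = p k (Function.update ω k (σ, 0)) := by
    refine had k _ _ (fun s hs => ?_) (by simp)
    rw [Function.update_of_ne hs.ne, Function.update_of_ne hs.ne]
  simp [drawProb, this, mul_assoc]

theorem sum_drawProb_update [NeZero N]
    (had : ∀ (t : Fin n) (ω ω' : Outcome n N),
      (∀ s < t, ω s = ω' s) → (ω t).1 = (ω' t).1 → p t ω = p t ω')
    (hp : ∀ t ω, p t ω ∈ stdSimplex ℝ (Fin N)) (k : Fin n) (ω : Outcome n N) :
    ∑ z : Playout n N × Fin N, drawProb p k (Function.update ω k z) = 1 := by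
  have h := sum_drawProb_update_mul had k ω (fun _ => 1)
  simp only [mul_one, (hp _ _).2, Finset.sum_const, Finset.card_univ, nsmul_eq_mul] at h
  rw [h, inv_mul_cancel₀ (by simp)]

theorem outcomeProb_nonneg (hp : ∀ t ω, p t ω ∈ stdSimplex ℝ (Fin N)) (ω : Outcome n N) :
    0 ≤ outcomeProb p ω := by
  rw [← partialProb_eq_outcomeProb]
  exact partialProb_nonneg hp n ω

theorem expect_mono (hp : ∀ t ω, p t ω ∈ stdSimplex ℝ (Fin N)) {X Y : Outcome n N → ℝ}
    (h : ∀ ω, X ω ≤ Y ω) : expect p X ≤ expect p Y :=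
  Finset.sum_le_sum fun ω _ => mul_le_mul_of_nonneg_left (h ω) (outcomeProb_nonneg hp ω)

theorem expect_sub (X Y : Outcome n N → ℝ) :
    expect p (fun ω => X ω - Y ω) = expect p X - expect p Y := by
  simp [expect, mul_sub]

theorem expect_const [NeZero N]
    (had : ∀ (t : Fin n) (ω ω' : Outcome n N),
      (∀ s < t, ω s = ω' s) → (ω t).1 = (ω' t).1 → p t ω = p t ω')
    (hp : ∀ t ω, p t ω ∈ stdSimplex ℝ (Fin N)) (a : ℝ) : expect p (fun _ => a) = a := by
  have hle : ∀ b : ℝ, expect p (fun _ => b) ≤ b := fun b =>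
    expect_le_of_supermartingale had hp (fun _ _ => b) b (fun _ => le_rfl) fun k ω => by
      rw [← Finset.sum_mul, sum_drawProb_update had hp, one_mul]
  refine le_antisymm (hle a) ?_
  have h := hle (-a)
  simp only [expect, mul_neg, Finset.sum_neg_distrib] at h ⊢
  linarith

end Law

/-! ### Random signs -/

section Signs

variable {N : ℕ}

theorem sum_signs_flip (i : Fin N) (F : (Fin N → ℤˣ) → ℝ) :
    ∑ ε : Fin N → ℤˣ, F (Pi.mulSingle i (-1 : ℤˣ) * ε) = ∑ ε, F ε :=
  Equiv.sum_comp (Equiv.mulLeft (Pi.mulSingle (M := fun _ : Fin N => ℤˣ) i (-1))) F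

theorem sum_sign (i : Fin N) : ∑ ε : Fin N → ℤˣ, ((ε i : ℤ) : ℝ) = 0 := by
  have h := sum_signs_flip i (fun ε => ((ε i : ℤ) : ℝ))
  simp only [Pi.mul_apply, Pi.mulSingle_eq_same, neg_mul, one_mul, Units.val_neg, Int.cast_neg,
    Finset.sum_neg_distrib] at h
  linarith

theorem sum_sign_mul_sign_of_ne {i j : Fin N} (hij : i ≠ j) :
    ∑ ε : Fin N → ℤˣ, ((ε i : ℤ) : ℝ) * ((ε j : ℤ) : ℝ) = 0 := by
  have h := sum_signs_flip i (fun ε => ((ε i : ℤ) : ℝ) * ((ε j : ℤ) : ℝ))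
  simp only [Pi.mul_apply, Pi.mulSingle_eq_same, Pi.mulSingle_eq_of_ne hij.symm, neg_mul, one_mul,
    Units.val_neg, Int.cast_neg, Finset.sum_neg_distrib] at h
  linarith

theorem intUnit_mul_self (u : ℤˣ) : ((u : ℤ) : ℝ) * ((u : ℤ) : ℝ) = 1 := by
  rcases Int.units_eq_one_or u with h | h <;> simp [h]

theorem sum_exp_sign (i : Fin N) (β : ℝ) :
    ∑ ε : Fin N → ℤˣ, Real.exp (β * ((ε i : ℤ) : ℝ)) =
      Fintype.card (Fin N → ℤˣ) * Real.cosh β := by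
  have h := sum_signs_flip i (fun ε => Real.exp (β * ((ε i : ℤ) : ℝ)))
  simp only [Pi.mul_apply, Pi.mulSingle_eq_same, neg_mul, one_mul, Units.val_neg, Int.cast_neg] at h
  have h2 : ∑ ε : Fin N → ℤˣ, (Real.exp (β * ((ε i : ℤ) : ℝ)) + Real.exp (β * -((ε i : ℤ) : ℝ)))
      = ∑ ε : Fin N → ℤˣ, 2 * Real.cosh β := by
    refine Finset.sum_congr rfl fun ε _ => ?_
    rw [Real.cosh_eq]
    rcases Int.units_eq_one_or (ε i) with h | h <;> simp [h] <;> ring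
  rw [Finset.sum_add_distrib, h, Finset.sum_const, Finset.card_univ, nsmul_eq_mul] at h2
  linarith

/-- Rademacher sums are sub-Gaussian. -/
theorem avg_exp_playout_le {n : ℕ} (i : Fin N) (β : ℝ) :
    (Fintype.card (Playout n N) : ℝ)⁻¹ *
      ∑ σ : Playout n N, Real.exp (β * ∑ s, ((σ s i : ℤ) : ℝ)) ≤ Real.exp (n * (β ^ 2 / 2)) := by
  have h1 : ∑ σ : Playout n N, Real.exp (β * ∑ s, ((σ s i : ℤ) : ℝ)) =
      (Fintype.card (Fin N → ℤˣ) * Real.cosh β) ^ n := by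
    rw [← sum_exp_sign i β, Fintype.sum_pow]
    refine Finset.sum_congr rfl fun σ _ => ?_
    rw [Finset.mul_sum, Real.exp_sum]
  rw [h1, mul_pow, show (Fintype.card (Playout n N) : ℝ) = (Fintype.card (Fin N → ℤˣ) : ℝ) ^ n by
    rw [Fintype.card_fun, Fintype.card_fin, Nat.cast_pow],
    inv_mul_cancel_left₀ (pow_ne_zero _ (by simp)), Real.exp_nat_mul]
  exact pow_le_pow_left₀ (Real.cosh_pos _).le (Real.cosh_le_exp_half_sq β) n

/-- The maximum of the `a j + 4 ε j c j` dominates the average with the random weights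
`q j (1 + (ε j - ε̄) / 2)`, where `ε̄ = ∑ q k ε k`; these are nonnegative, sum to one, and are tilted
towards the positive signs. -/
theorem le_avg_iSup_signs [NeZero N] (a c q : Fin N → ℝ) (hq : q ∈ stdSimplex ℝ (Fin N)) :
    ∑ j, q j * (a j + 2 * (1 - q j) * c j) ≤
      (Fintype.card (Fin N → ℤˣ) : ℝ)⁻¹ *
        ∑ ε : Fin N → ℤˣ, ⨆ j, (a j + 4 * (((ε j : ℤ) : ℝ) * c j)) := by
  have hcard : (0 : ℝ) < Fintype.card (Fin N → ℤˣ) := by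
    exact_mod_cast Fintype.card_pos
  rw [← div_eq_inv_mul, le_div_iff₀ hcard]
  have hpt : ∀ ε : Fin N → ℤˣ,
      ∑ j, q j * (1 + (((ε j : ℤ) : ℝ) - ∑ k, q k * ((ε k : ℤ) : ℝ)) / 2) *
        (a j + 4 * (((ε j : ℤ) : ℝ) * c j)) ≤ ⨆ j, (a j + 4 * (((ε j : ℤ) : ℝ) * c j)) := by
    intro ε
    have habs : ∀ j, |((ε j : ℤ) : ℝ)| ≤ 1 := fun j => by
      rcases Int.units_eq_one_or (ε j) with h | h <;> simp [h]
    have hbar : ∑ k, q k * ((ε k : ℤ) : ℝ) ≤ 1 := by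
      rw [← hq.2]
      exact Finset.sum_le_sum fun k _ =>
        mul_le_of_le_one_right (hq.1 k) (abs_le.1 (habs k)).2
    have hw : ∀ j, 0 ≤ q j * (1 + (((ε j : ℤ) : ℝ) - ∑ k, q k * ((ε k : ℤ) : ℝ)) / 2) :=
      fun j => mul_nonneg (hq.1 j) (by linarith [(abs_le.1 (habs j)).1])
    have hw1 : ∑ j, q j * (1 + (((ε j : ℤ) : ℝ) - ∑ k, q k * ((ε k : ℤ) : ℝ)) / 2) = 1 := by
      have : ∀ j, q j * (1 + (((ε j : ℤ) : ℝ) - ∑ k, q k * ((ε k : ℤ) : ℝ)) / 2) =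
          q j + (q j * ((ε j : ℤ) : ℝ)) / 2 - q j * (∑ k, q k * ((ε k : ℤ) : ℝ)) / 2 :=
        fun j => by ring
      simp only [this]
      rw [Finset.sum_sub_distrib, Finset.sum_add_distrib, ← Finset.sum_div, ← Finset.sum_div,
        ← Finset.sum_mul, hq.2]
      ring
    calc _ ≤ ∑ j, q j * (1 + (((ε j : ℤ) : ℝ) - ∑ k, q k * ((ε k : ℤ) : ℝ)) / 2) *
          ⨆ j, (a j + 4 * (((ε j : ℤ) : ℝ) * c j)) :=
        Finset.sum_le_sum fun j _ => mul_le_mul_of_nonneg_left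
          (le_ciSup (f := fun j => a j + 4 * (((ε j : ℤ) : ℝ) * c j))
            (Set.finite_range _).bddAbove j) (hw j)
      _ = _ := by rw [← Finset.sum_mul, hw1, one_mul]
  refine le_trans (le_of_eq ?_) (Finset.sum_le_sum fun ε _ => hpt ε)
  rw [Finset.sum_comm, Finset.sum_mul]
  refine Finset.sum_congr rfl fun j _ => ?_
  have hcross : ∑ ε : Fin N → ℤˣ, ((ε j : ℤ) : ℝ) * (∑ k, q k * ((ε k : ℤ) : ℝ)) =
      Fintype.card (Fin N → ℤˣ) * q j := by
    simp only [Finset.mul_sum]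
    rw [Finset.sum_comm, Finset.sum_eq_single j]
    · have : ∀ ε : Fin N → ℤˣ, ((ε j : ℤ) : ℝ) * (q j * ((ε j : ℤ) : ℝ)) = q j := fun ε => by
        rw [mul_left_comm, intUnit_mul_self, mul_one]
      simp [this]
    · intro k _ hk
      have := sum_sign_mul_sign_of_ne hk.symm
      simp only [mul_left_comm _ (q k)]
      rw [← Finset.mul_sum, this, mul_zero]
    · simp
  have hbar : ∑ ε : Fin N → ℤˣ, (∑ k, q k * ((ε k : ℤ) : ℝ)) = 0 := by
    rw [Finset.sum_comm]
    simp [← Finset.mul_sum, sum_sign]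
  have hexp : ∀ ε : Fin N → ℤˣ,
      q j * (1 + (((ε j : ℤ) : ℝ) - ∑ k, q k * ((ε k : ℤ) : ℝ)) / 2) *
        (a j + 4 * (((ε j : ℤ) : ℝ) * c j)) =
      q j * (a j + 2 * c j) + (q j * a j / 2 + 4 * q j * c j) * ((ε j : ℤ) : ℝ) -
        q j * a j / 2 * (∑ k, q k * ((ε k : ℤ) : ℝ)) -
        2 * q j * c j * (((ε j : ℤ) : ℝ) * (∑ k, q k * ((ε k : ℤ) : ℝ))) := by
    intro ε
    linear_combination (2 * q j * c j) * intUnit_mul_self (ε j)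
  simp only [hexp]
  rw [Finset.sum_sub_distrib, Finset.sum_sub_distrib, Finset.sum_add_distrib, ← Finset.mul_sum,
    ← Finset.mul_sum, ← Finset.mul_sum, ← Finset.mul_sum, hcross, hbar, sum_sign, Finset.sum_const,
    Finset.card_univ, nsmul_eq_mul]
  ring

end Signs

/-! ### Mirror Descent in a uniformly convex space -/

section MirrorDescent

variable {E : Type*} [NormedAddCommGroup E] [NormedSpace ℝ E]

theorem IsSubgradientAt.le_lipschitz {h : E → ℝ} {L : ℝ≥0} (hL : LipschitzWith L h)
    {φ : StrongDual ℝ E} {x : E} (hφ : IsSubgradientAt h φ x) (y : E) : φ y ≤ L * ‖y‖ := by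
  have h1 := hφ (x + y)
  have h2 := hL.dist_le_mul (x + y) x
  rw [Real.dist_eq, dist_eq_norm, add_sub_cancel_left] at h2
  rw [add_sub_cancel_left] at h1
  linarith [(abs_le.1 h2).2]

/-- Testing the strong convexity of `ℛ` at the midpoint bounds its Bregman divergence from below.
The modulus is half of the optimal one. -/
theorem IsSubgradientAt.le_bregman {ℛ : E → ℝ} {lam : ℝ}
    (hℛ : StrongConvexOn Set.univ lam ℛ) {φ : StrongDual ℝ E} {w : E}
    (hφ : IsSubgradientAt ℛ φ w) (u : E) : lam / 4 * ‖u - w‖ ^ 2 ≤ bregman ℛ φ u w := by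
  have h1 := hℛ.2 (Set.mem_univ u) (Set.mem_univ w)
    (by norm_num : (0 : ℝ) ≤ 1 / 2) (by norm_num : (0 : ℝ) ≤ 1 / 2) (by norm_num)
  have h2 := hφ ((1 / 2 : ℝ) • u + (1 / 2 : ℝ) • w)
  have h3 : (1 / 2 : ℝ) • u + (1 / 2 : ℝ) • w - w = (1 / 2 : ℝ) • (u - w) := by
    module
  rw [h3, map_smul] at h2
  simp only [smul_eq_mul] at h1 h2
  rw [bregman]
  linarith

theorem strongConvexOn_of_regularizer {lam : ℝ} (hlam : 0 < lam) (hE : IsTwoUniformlyConvex E lam)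
    {ℛ : E → ℝ} (hℛ : ℛ = (fun w => ‖w‖ ^ 2 / 2) ∨ ℛ = (fun w => ‖w‖ ^ 2)) :
    StrongConvexOn Set.univ lam ℛ := by
  rcases hℛ with rfl | rfl
  · exact hE
  · refine ⟨convex_univ, fun x hx y hy a b ha hb hab => ?_⟩
    have h := hE.2 hx hy ha hb hab
    simp only [smul_eq_mul] at h ⊢
    have : 0 ≤ a * b * (lam / 2 * ‖x - y‖ ^ 2) := by positivity
    linarith

/-- A nontrivial space is at most `1`-strongly convex: test at `0`, `x` and `x / 2`. -/
theorem IsTwoUniformlyConvex.le_one [Nontrivial E] {lam : ℝ} (hE : IsTwoUniformlyConvex E lam) :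
    lam ≤ 1 := by
  obtain ⟨x, hx⟩ := exists_ne (0 : E)
  have h := hE.2 (Set.mem_univ x) (Set.mem_univ 0)
    (by norm_num : (0 : ℝ) ≤ 1 / 2) (by norm_num : (0 : ℝ) ≤ 1 / 2) (by norm_num)
  simp only [smul_zero, add_zero, norm_smul, sub_zero, norm_zero, smul_eq_mul, mul_pow] at h
  norm_num at h
  have : 0 < ‖x‖ ^ 2 := by positivity
  nlinarith

variable {n : ℕ} {η : ℝ} {W : Set E} {ℛ : E → ℝ} {h : Fin n → E → ℝ} {w : Fin n → E}

theorem IsMirrorDescent.mem (hw : IsMirrorDescent η W ℛ h w) (t : Fin n) : w t ∈ W := by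
  obtain ⟨g, φ, v, -, -, h0, h1⟩ := hw
  obtain ⟨k, hk⟩ := t
  cases k with
  | zero => exact (h0 ⟨0, hk⟩ rfl).1
  | succ k => exact (h1 ⟨k, by omega⟩ ⟨k + 1, hk⟩ rfl).2.1

/-- In each round the linearized regret is at most the decrease of the Bregman divergence to the
comparator, plus a term of second order in the step size; the decreases telescope. The last round
has no successor, and there the remaining divergence itself is used. -/
theorem IsMirrorDescent.regret_le (hw : IsMirrorDescent η W ℛ h w) (hη : 0 < η) {lam : ℝ}
    (hlam : 0 < lam) (hℛ : StrongConvexOn Set.univ lam ℛ) (hℛ0 : ∀ x, 0 ≤ ℛ x) {L : ℝ≥0}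
    (hL : ∀ t, LipschitzWith L (h t)) {u : E} (hu : u ∈ W) :
    η * (∑ t, h t (w t) - ∑ t, h t u) ≤ ℛ u + n * (η ^ 2 * L ^ 2 / lam) := by
  obtain ⟨g, φ, v, hg, hφ, h0, h1⟩ := hw
  have hquad : ∀ d : ℝ, η * (L * d) - lam / 4 * d ^ 2 ≤ η ^ 2 * L ^ 2 / lam := by
    intro d
    rw [le_div_iff₀ hlam]
    nlinarith [sq_nonneg (lam * d / 2 - η * L)]
  have hlin : ∀ t, h t (w t) - h t u ≤ g t (w t - u) := fun t => by
    have := hg t u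
    rw [← neg_sub (w t) u, map_neg] at this
    linarith
  have hlast : ∀ t, η * (h t (w t) - h t u) ≤
      bregman ℛ (φ t) u (w t) + η ^ 2 * L ^ 2 / lam := fun t => by
    have e1 := mul_le_mul_of_nonneg_left
      ((hlin t).trans ((hg t).le_lipschitz (hL t) (w t - u))) hη.le
    have e2 := hquad ‖w t - u‖
    have e3 := (hφ t).le_bregman hℛ u
    rw [norm_sub_rev] at e3
    linarith
  have hstep : ∀ t t' : Fin n, (t' : ℕ) = t + 1 → η * (h t (w t) - h t u) ≤
      bregman ℛ (φ t) u (w t) - bregman ℛ (φ t') u (w t') + η ^ 2 * L ^ 2 / lam := by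
    intro t t' htt'
    have e1 := mul_le_mul_of_nonneg_left ((hg t).le_lipschitz (hL t) (w t - w t')) hη.le
    have e2 := hquad ‖w t - w t'‖
    have e3 := (hφ t).le_bregman hℛ (w t')
    rw [norm_sub_rev] at e3
    have e4 := (h1 t t' htt').2.2.2 u hu
    have e5 := mul_le_mul_of_nonneg_left (hlin t) hη.le
    simp only [bregman, map_sub, sub_apply, smul_apply,
      smul_eq_mul] at e1 e3 e4 e5 ⊢
    linarith
  have hsum : ∀ k, ∀ hk : k < n,
      η * ∑ t ∈ Finset.Iio (⟨k, hk⟩ : Fin n), (h t (w t) - h t u) ≤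
        ℛ u - bregman ℛ (φ ⟨k, hk⟩) u (w ⟨k, hk⟩) + k * (η ^ 2 * L ^ 2 / lam) := by
    intro k
    induction k with
    | zero =>
      intro hk
      have e1 := (h0 ⟨0, hk⟩ rfl).2.2 u hu
      have e2 := hℛ0 (w ⟨0, hk⟩)
      have : Finset.Iio (⟨0, hk⟩ : Fin n) = ∅ := by
        ext t; simp [Fin.lt_def]
      rw [this, bregman, Finset.sum_empty, mul_zero, Nat.cast_zero, zero_mul]
      linarith
    | succ k ih =>
      intro hk
      have hk' : k < n := by omega
      have : Finset.Iio (⟨k + 1, hk⟩ : Fin n) = insert ⟨k, hk'⟩ (Finset.Iio ⟨k, hk'⟩) := by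
        ext t
        simp only [Finset.mem_Iio, Finset.mem_insert, Fin.lt_def, Fin.ext_iff]
        omega
      rw [this, Finset.sum_insert (by simp), mul_add]
      have e1 := ih hk'
      have e2 := hstep ⟨k, hk'⟩ ⟨k + 1, hk⟩ rfl
      push_cast
      linarith
  rw [← Finset.sum_sub_distrib]
  rcases Nat.eq_zero_or_pos n with rfl | hn
  · simpa using hℛ0 u
  · obtain ⟨m, rfl⟩ : ∃ m, n = m + 1 := ⟨n - 1, by omega⟩
    have : (Finset.univ : Finset (Fin (m + 1))) =
        insert ⟨m, by omega⟩ (Finset.Iio ⟨m, by omega⟩) := by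
      ext t
      have := t.2
      simp only [Finset.mem_Iio, Finset.mem_insert, Fin.lt_def, Fin.ext_iff, Finset.mem_univ,
        true_iff]
      omega
    rw [this, Finset.sum_insert (by simp), mul_add]
    have e1 := hsum m (by omega)
    have e2 := hlast ⟨m, by omega⟩
    push_cast
    linarith

/-- With the step size that balances the two terms, Mirror Descent on the ball of radius `R` has
regret `O(R L √(n / lam))`. -/
theorem IsMirrorDescent.regret_ball_le {R lam : ℝ} {L : ℝ≥0} (hR : 0 < R) (hL0 : 1 ≤ L)
    (hn : 1 ≤ n) (hlam : 0 < lam) (hE : IsTwoUniformlyConvex E lam)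
    (hℛ : ℛ = (fun w => ‖w‖ ^ 2 / 2) ∨ ℛ = (fun w => ‖w‖ ^ 2))
    (hw : IsMirrorDescent (R / L * √(lam / n)) {w : E | ‖w‖ ≤ R} ℛ h w)
    (hL : ∀ t, LipschitzWith L (h t)) {u : E} (hu : ‖u‖ ≤ R) :
    ∑ t, h t (w t) - ∑ t, h t u ≤ 2 * (R * L * √(n / lam)) := by
  have hL1 : (1 : ℝ) ≤ L := by exact_mod_cast hL0
  have hn1 : (1 : ℝ) ≤ n := by exact_mod_cast hn
  have hη : 0 < R / L * √(lam / n) := by positivity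
  have hℛ0 : ∀ x, 0 ≤ ℛ x := by
    rcases hℛ with rfl | rfl <;> intro x <;> positivity
  have hℛu : ℛ u ≤ R ^ 2 := by
    have : ‖u‖ ^ 2 ≤ R ^ 2 := pow_le_pow_left₀ (norm_nonneg _) hu 2
    rcases hℛ with rfl | rfl
    · have := sq_nonneg ‖u‖
      simp only
      linarith
    · exact this
  have key := hw.regret_le hη hlam (strongConvexOn_of_regularizer hlam hE hℛ) hℛ0 hL (u := u) hu
  have h1 : (R / L * √(lam / n)) ^ 2 = R ^ 2 * lam / (L ^ 2 * n) := by
    rw [mul_pow, Real.sq_sqrt (by positivity)]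
    field_simp
  have h2 : n * ((R / L * √(lam / n)) ^ 2 * L ^ 2 / lam) = R ^ 2 := by
    rw [h1]
    field_simp
  have h3 : (R / L * √(lam / n)) * (2 * (R * L * √(n / lam))) = 2 * R ^ 2 := by
    have : √(lam / n) * √(n / lam) = 1 := by
      rw [← Real.sqrt_mul (by positivity), div_mul_div_cancel₀ (by positivity),
        div_self hlam.ne', Real.sqrt_one]
    field_simp
    linear_combination this
  refine le_of_mul_le_mul_left ?_ hη
  rw [h3]
  linarith

/-- The first iterate minimizes the norm. -/
theorem IsMirrorDescent.first_eq_zero {R : ℝ} (hR : 0 < R)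
    (hℛ : ℛ = (fun w => ‖w‖ ^ 2 / 2) ∨ ℛ = (fun w => ‖w‖ ^ 2))
    (hw : IsMirrorDescent η {w : E | ‖w‖ ≤ R} ℛ h w) {t : Fin n} (ht : (t : ℕ) = 0) :
    w t = 0 := by
  obtain ⟨g, φ, v, -, -, h0, -⟩ := hw
  have := (h0 t ht).2.1 (show (0 : E) ∈ {w : E | ‖w‖ ≤ R} by simpa using hR.le)
  have h2 : ‖w t‖ ^ 2 ≤ 0 := by
    rcases hℛ with rfl | rfl
    · simp only [Set.mem_ofPred_eq, norm_zero] at this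
      linarith
    · simpa using this
  exact norm_eq_zero.1 (pow_eq_zero_iff two_ne_zero |>.1 (le_antisymm h2 (sq_nonneg _)))

end MirrorDescent

/-! ### One round of the multi-scale experts algorithm -/

section Round

variable {n N : ℕ}

/-- The right side is the supremum of the left side over the box `|x i| ≤ c i`: against the index
`i` the worst loss vector is `-c i` at `i` and `c j` elsewhere. -/
theorem sum_mul_add_iSup_sub_le [NeZero N] {q c : Fin N → ℝ} (hq : q ∈ stdSimplex ℝ (Fin N))
    (b x : Fin N → ℝ) (hx : ∀ i, |x i| ≤ c i) :
    ∑ i, q i * x i + ⨆ i, (b i - x i) ≤ ∑ i, q i * c i + ⨆ i, (b i + c i - 2 * q i * c i) := by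
  have h : ⨆ i, (b i - x i) ≤
      ∑ i, q i * (c i - x i) + ⨆ i, (b i + c i - 2 * q i * c i) := by
    refine ciSup_le fun i => ?_
    have h1 : q i * (c i - x i) ≤ ∑ j, q j * (c j - x j) :=
      Finset.single_le_sum (f := fun j => q j * (c j - x j))
        (fun j _ => mul_nonneg (hq.1 j) (by linarith [(abs_le.1 (hx j)).2])) (Finset.mem_univ i)
    have h2 : b i + c i - 2 * q i * c i ≤ ⨆ i, (b i + c i - 2 * q i * c i) :=
      le_ciSup (f := fun i => b i + c i - 2 * q i * c i) (Set.finite_range _).bddAbove i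
    have h3 : q i ≤ 1 := hq.2 ▸ Finset.single_le_sum (fun j _ => hq.1 j) (Finset.mem_univ i)
    have h4 : 0 ≤ (1 - q i) * (c i + x i) :=
      mul_nonneg (by linarith) (by linarith [(abs_le.1 (hx i)).1])
    linarith
  simp only [mul_sub, Finset.sum_sub_distrib] at h
  linarith

/-- Water filling: some `q` in the simplex levels the numbers `b j + c j - 2 q j c j` on its
support, and the level bounds the others. -/
theorem exists_waterFilling [NeZero N] (b : Fin N → ℝ) {c : Fin N → ℝ} (hc : ∀ i, 0 < c i) :
    ∃ q ∈ stdSimplex ℝ (Fin N), ∃ ℓ : ℝ, ∀ j,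
      b j + c j - 2 * q j * c j ≤ ℓ ∧ q j * (b j + c j - 2 * q j * c j) = q j * ℓ := by
  set F : ℝ → ℝ := fun ℓ => ∑ j, max 0 (b j + c j - ℓ) / (2 * c j) with hF
  have hcont : Continuous F := by
    refine continuous_finsetSum _ fun j _ => ?_
    exact (continuous_const.max (continuous_const.sub continuous_id)).div_const _
  have hterm : ∀ ℓ j, 0 ≤ max 0 (b j + c j - ℓ) / (2 * c j) := fun ℓ j =>
    div_nonneg (le_max_left _ _) (by linarith [hc j])
  have hlow : 1 ≤ F (b 0 - c 0) := by
    refine le_trans ?_ (Finset.single_le_sum (f := fun j => max 0 (b j + c j - (b 0 - c 0)) /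
      (2 * c j)) (fun j _ => hterm _ j) (Finset.mem_univ 0))
    rw [le_div_iff₀ (by linarith [hc 0])]
    refine le_trans (by linarith) (le_max_right _ _)
  have hhigh : F (⨆ j, (b j + c j)) ≤ 1 := by
    have : F (⨆ j, (b j + c j)) = 0 := by
      refine Finset.sum_eq_zero fun j _ => ?_
      rw [max_eq_left, zero_div]
      have := le_ciSup (f := fun j => b j + c j) (Set.finite_range _).bddAbove j
      linarith
    linarith
  obtain ⟨ℓ, hℓ⟩ := mem_range_of_exists_le_of_exists_ge hcont ⟨_, hhigh⟩ ⟨_, hlow⟩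
  refine ⟨fun j => max 0 (b j + c j - ℓ) / (2 * c j), ⟨hterm ℓ, hℓ⟩, ℓ, fun j => ?_⟩
  have hq : 2 * (max 0 (b j + c j - ℓ) / (2 * c j)) * c j = max 0 (b j + c j - ℓ) := by
    have := (hc j).ne'
    field_simp
  simp only [hq]
  rcases le_total (b j + c j - ℓ) 0 with h | h
  · rw [max_eq_left h]
    exact ⟨by linarith, by simp⟩
  · rw [max_eq_right h]
    exact ⟨by linarith, by ring⟩

/-- The score of expert `i` after `k` rounds: minus its losses in the first `k` rounds, plus the
playout of the remaining rounds by the signs `σ`, minus its penalty. Only the signs of the rounds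
from `k` on matter. -/
def relaxedScore (c π : Fin N → ℝ) (g : Fin n → Fin N → ℝ) (k : ℕ) (σ : Playout n N)
    (i : Fin N) : ℝ :=
  -(∑ s ∈ Finset.univ.filter (fun s : Fin n => (s : ℕ) < k), g s i) +
    4 * ∑ s ∈ Finset.univ.filter (fun s : Fin n => k ≤ (s : ℕ)), ((σ s i : ℤ) : ℝ) * c i -
    ftplPenalty n c π i

theorem filter_lt_succ (t : Fin n) :
    (Finset.univ.filter fun s : Fin n => (s : ℕ) < t + 1) = insert t (Finset.Iio t) := by
  ext s
  simp only [Finset.mem_filter, Finset.mem_univ, true_and, Finset.mem_insert, Finset.mem_Iio,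
    Fin.lt_def, Fin.ext_iff]
  omega

theorem filter_lt (t : Fin n) :
    (Finset.univ.filter fun s : Fin n => (s : ℕ) < t) = Finset.Iio t := by
  ext s
  simp

theorem filter_succ_le (t : Fin n) :
    (Finset.univ.filter fun s : Fin n => t + 1 ≤ (s : ℕ)) = Finset.Ioi t := by
  ext s
  simp

theorem filter_le (t : Fin n) :
    (Finset.univ.filter fun s : Fin n => (t : ℕ) ≤ (s : ℕ)) = insert t (Finset.Ioi t) := by
  ext s
  simp only [Finset.mem_filter, Finset.mem_univ, true_and, Finset.mem_insert, Finset.mem_Ioi,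
    Fin.lt_def, Fin.ext_iff]
  omega

theorem relaxedScore_congr (c π : Fin N → ℝ) {g g' : Fin n → Fin N → ℝ} {k : ℕ}
    (h : ∀ s : Fin n, (s : ℕ) < k → g s = g' s) : relaxedScore c π g k = relaxedScore c π g' k := by
  funext σ i
  rw [relaxedScore, relaxedScore, Finset.sum_congr rfl fun s hs => by
    rw [h s (Finset.mem_filter.1 hs).2]]

theorem ftplObjective_congr (c π : Fin N → ℝ) {g g' : Fin n → Fin N → ℝ} {t : Fin n}
    (h : ∀ s < t, g s = g' s) : ftplObjective c π t g = ftplObjective c π t g' := by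
  funext σ q
  have : ∀ i, ∑ s ∈ Finset.Iio t, g s i = ∑ s ∈ Finset.Iio t, g' s i := fun i =>
    Finset.sum_congr rfl fun s hs => by rw [h s (Finset.mem_Iio.1 hs)]
  simp only [ftplObjective, this]

theorem sum_mul_add_iSup_relaxedScore_le_ftplObjective [NeZero N] (c π : Fin N → ℝ) (t : Fin n)
    {g : Fin n → Fin N → ℝ} (hg : ∀ i, |g t i| ≤ c i) (σ : Playout n N) {q : Fin N → ℝ}
    (hq : q ∈ stdSimplex ℝ (Fin N)) :
    ∑ i, q i * g t i + ⨆ i, relaxedScore c π g (t + 1) σ i ≤ ftplObjective c π t g σ q := by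
  have h := le_ciSup (f := fun x : {x : Fin N → ℝ // ∀ i, |x i| ≤ c i} =>
    (∑ i, q i * x.1 i +
      ⨆ i, (-(∑ s ∈ Finset.Iio t, g s i + x.1 i)
        + 4 * ∑ s ∈ Finset.Ioi t, ((σ s i : ℤ) : ℝ) * c i - ftplPenalty n c π i))) ?_ ⟨g t, hg⟩
  · refine le_trans (le_of_eq ?_) h
    simp only [relaxedScore, filter_lt_succ, filter_succ_le]
    congr 2
    funext i
    rw [Finset.sum_insert (by simp), add_comm (g t i)]
  · set b : Fin N → ℝ := fun i => -(∑ s ∈ Finset.Iio t, g s i)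
        + 4 * ∑ s ∈ Finset.Ioi t, ((σ s i : ℤ) : ℝ) * c i - ftplPenalty n c π i with hb
    refine ⟨∑ i, q i * c i + ⨆ i, (b i + c i - 2 * q i * c i), Set.forall_mem_range.2 fun x => ?_⟩
    refine le_trans (le_of_eq ?_) (sum_mul_add_iSup_sub_le hq b x.1 x.2)
    congr 2
    funext i
    rw [hb]
    ring

/-- The water-filling distribution `q` has objective at most `∑ q j (b j + 2 (1 - q j) c j)`, which
fresh signs for round `t` dominate. -/
theorem exists_ftplObjective_le [NeZero N] {c : Fin N → ℝ} (hc : ∀ i, 0 < c i) (π : Fin N → ℝ)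
    (t : Fin n) (g : Fin n → Fin N → ℝ) (σ : Playout n N) :
    ∃ q ∈ stdSimplex ℝ (Fin N), ftplObjective c π t g σ q ≤
      (Fintype.card (Fin N → ℤˣ) : ℝ)⁻¹ *
        ∑ ε : Fin N → ℤˣ, ⨆ j, relaxedScore c π g t (Function.update σ t ε) j := by
  set b : Fin N → ℝ := fun i => -(∑ s ∈ Finset.Iio t, g s i)
        + 4 * ∑ s ∈ Finset.Ioi t, ((σ s i : ℤ) : ℝ) * c i - ftplPenalty n c π i with hb
  obtain ⟨q, hq, ℓ, hℓ⟩ := exists_waterFilling b hc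
  refine ⟨q, hq, ?_⟩
  have hupd : ∀ (ε : Fin N → ℤˣ) j, relaxedScore c π g t (Function.update σ t ε) j =
      b j + 4 * (((ε j : ℤ) : ℝ) * c j) := by
    intro ε j
    have : ∑ s ∈ Finset.Ioi t, (((Function.update σ t ε) s j : ℤ) : ℝ) * c j =
        ∑ s ∈ Finset.Ioi t, ((σ s j : ℤ) : ℝ) * c j :=
      Finset.sum_congr rfl fun s hs => by
        rw [Function.update_of_ne (Finset.mem_Ioi.1 hs).ne']
    rw [relaxedScore, filter_lt, filter_le, Finset.sum_insert (by simp), this,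
      Function.update_self, hb]
    ring
  simp only [hupd]
  refine le_trans ?_ (le_avg_iSup_signs b c q hq)
  have : Nonempty {x : Fin N → ℝ // ∀ i, |x i| ≤ c i} :=
    ⟨⟨0, fun i => by simpa using (hc i).le⟩⟩
  refine ciSup_le fun x => ?_
  have hx := sum_mul_add_iSup_sub_le hq b x.1 x.2
  have hsup : ⨆ i, (b i + c i - 2 * q i * c i) ≤ ℓ := ciSup_le fun i => (hℓ i).1
  have hval : ∑ j, q j * (b j + 2 * (1 - q j) * c j) = ∑ j, q j * c j + ℓ := by
    have : ∀ j, q j * (b j + 2 * (1 - q j) * c j) = q j * c j + q j * ℓ := fun j => by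
      rw [← (hℓ j).2]
      ring
    rw [Finset.sum_congr rfl fun j _ => this j, Finset.sum_add_distrib, ← Finset.sum_mul, hq.2,
      one_mul]
  rw [hval]
  refine le_trans (le_of_eq ?_) (hx.trans (by linarith))
  congr 2
  funext i
  rw [hb]
  ring

end Round

/-! ### The regret of the multi-scale experts algorithm -/

section Experts

variable {n N : ℕ}

/-- The loss suffered in the first `k` rounds plus the expected maximal score of the experts over a
uniform playout of the remaining rounds. -/
def ftplPotential (c π : Fin N → ℝ) (g : Fin n → Outcome n N → Fin N → ℝ) (k : ℕ)
    (ω : Outcome n N) : ℝ :=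
  ∑ s ∈ Finset.univ.filter (fun s : Fin n => (s : ℕ) < k), g s ω (ω s).2 +
    (Fintype.card (Playout n N) : ℝ)⁻¹ *
      ∑ σ : Playout n N, ⨆ i, relaxedScore c π (fun s => g s ω) k σ i

/-- The potential is a supermartingale. The index of round `k` is averaged over the learner's
distribution, and the fresh signs `ε` of `exists_ftplObjective_le` become the signs of round `k` in
the playout. -/
theorem ftplPotential_step [NeZero N] {c π : Fin N → ℝ} (hc : ∀ i, 0 < c i)
    {g : Fin n → Outcome n N → Fin N → ℝ} {p : Fin n → Outcome n N → Fin N → ℝ}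
    (hp : IsMultiScaleFTPL c π g p) (hg : IsPredictable g) (hgc : ∀ t ω i, |g t ω i| ≤ c i)
    (k : Fin n) (ω : Outcome n N) :
    ∑ z, drawProb p k (Function.update ω k z) *
      ftplPotential c π g (k + 1) (Function.update ω k z) ≤ ftplPotential c π g k ω := by
  have hgu : ∀ z, ∀ s ≤ k, g s (Function.update ω k z) = g s ω := fun z s hs =>
    hg s _ _ fun r hr => Function.update_of_ne (hr.trans_le hs).ne _ _
  set A : ℝ := ∑ s ∈ Finset.Iio k, g s ω (ω s).2 + (Fintype.card (Playout n N) : ℝ)⁻¹ *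
    ∑ σ : Playout n N, ⨆ i, relaxedScore c π (fun s => g s ω) (k + 1) σ i with hA
  have hpot : ∀ z, ftplPotential c π g (k + 1) (Function.update ω k z) = A + g k ω z.2 := by
    intro z
    have h1 : relaxedScore c π (fun s => g s (Function.update ω k z)) (k + 1) =
        relaxedScore c π (fun s => g s ω) (k + 1) :=
      relaxedScore_congr c π fun s hs => hgu z s (Nat.lt_succ_iff.1 hs)
    have h2 : ∑ s ∈ Finset.Iio k, g s (Function.update ω k z) (Function.update ω k z s).2 =
        ∑ s ∈ Finset.Iio k, g s ω (ω s).2 :=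
      Finset.sum_congr rfl fun s hs => by
        have hs := Finset.mem_Iio.1 hs
        rw [hgu z s hs.le, Function.update_of_ne hs.ne]
    rw [ftplPotential, h1, filter_lt_succ, Finset.sum_insert (by simp), h2, hgu z k le_rfl,
      Function.update_self, hA]
    ring
  simp only [hpot, mul_add]
  rw [Finset.sum_add_distrib, ← Finset.sum_mul, sum_drawProb_update hp.adapted hp.mem_simplex,
    one_mul, sum_drawProb_update_mul hp.adapted, ftplPotential, filter_lt, hA, add_assoc, ← mul_add,
    ← Finset.sum_add_distrib]
  refine add_le_add le_rfl (mul_le_mul_of_nonneg_left ?_ (by positivity))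
  rw [sum_pi_eq_sum_update (fun σ : Playout n N => ⨆ i, relaxedScore c π (fun s => g s ω) k σ i) k,
    Finset.mul_sum]
  refine Finset.sum_le_sum fun σ _ => ?_
  obtain ⟨q, hq, hle⟩ := exists_ftplObjective_le hc π k (fun s => g s ω) σ
  refine le_trans ?_ hle
  have hmin := hp.isMinOn k (Function.update ω k (σ, 0)) hq
  rw [Set.mem_ofPred_eq, Function.update_self,
    ftplObjective_congr c π (g' := fun s => g s ω) fun s hs => hgu _ s hs.le] at hmin
  refine le_trans ?_ hmin
  rw [add_comm]
  exact sum_mul_add_iSup_relaxedScore_le_ftplObjective c π k (g := fun s => g s ω) (hgc k ω) σ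
    (hp.mem_simplex _ _)

/-- The maximum is inside the expectation, so the bound holds against an expert that is chosen with
knowledge of all draws. -/
theorem expect_ftpl_regret_le [NeZero N] {c π : Fin N → ℝ} (hc : ∀ i, 0 < c i)
    {g : Fin n → Outcome n N → Fin N → ℝ} {p : Fin n → Outcome n N → Fin N → ℝ}
    (hp : IsMultiScaleFTPL c π g p) (hg : IsPredictable g) (hgc : ∀ t ω i, |g t ω i| ≤ c i) :
    expect p (fun ω => ∑ t, g t ω (ω t).2 + ⨆ i, (-(∑ t, g t ω i) - ftplPenalty n c π i)) ≤
      (Fintype.card (Playout n N) : ℝ)⁻¹ *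
        ∑ σ : Playout n N, ⨆ i, (4 * ∑ s, ((σ s i : ℤ) : ℝ) * c i - ftplPenalty n c π i) := by
  have h := expect_le_of_supermartingale hp.adapted hp.mem_simplex (ftplPotential c π g)
    ((Fintype.card (Playout n N) : ℝ)⁻¹ *
      ∑ σ : Playout n N, ⨆ i, (4 * ∑ s, ((σ s i : ℤ) : ℝ) * c i - ftplPenalty n c π i))
    (fun ω => le_of_eq (by
      simp only [ftplPotential, relaxedScore, Nat.not_lt_zero, Finset.filter_false,
        Finset.sum_empty, Nat.zero_le, Finset.filter_true, neg_zero, zero_add]))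
    (ftplPotential_step hc hp hg hgc)
  refine le_trans (le_of_eq ?_) h
  congr 1
  funext ω
  have h1 : (Finset.univ.filter fun s : Fin n => (s : ℕ) < n) = Finset.univ := by
    ext s; simp
  have h2 : (Finset.univ.filter fun s : Fin n => n ≤ (s : ℕ)) = ∅ := by
    ext s; simp
  simp only [ftplPotential, relaxedScore, h1, h2, Finset.sum_empty, mul_zero, add_zero,
    Finset.sum_const, Finset.card_univ, nsmul_eq_mul]
  rw [inv_mul_cancel_left₀ (by simp)]

/-- An exponential moment bound at `α = √(log X) / (4 c √n)`, `X = 4 c² n (n + 1)`: the penalty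
makes the exponent `(1/2 - 5/4) log X ≤ -(log X) / 2`, and `√X = 2 c √n √(n + 1)`. -/
theorem avg_iSup_signs_sub_penalty_le (hn : 1 ≤ n) {c : Fin (n + 1) → ℝ} (hc : ∀ i, 1 ≤ c i) :
    (Fintype.card (Playout n (n + 1)) : ℝ)⁻¹ *
      ∑ σ : Playout n (n + 1), ⨆ i, (4 * ∑ s, ((σ s i : ℤ) : ℝ) * c i -
        ftplPenalty n c (fun _ => 1 / ((n : ℝ) + 1)) i) ≤ 4 * √n := by
  have hn1 : (1 : ℝ) ≤ n := by exact_mod_cast hn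
  have hterm : ∀ i, ∃ α : ℝ, 0 < α ∧ (Fintype.card (Playout n (n + 1)) : ℝ)⁻¹ *
      ∑ σ : Playout n (n + 1), α⁻¹ * Real.exp (α * (4 * ∑ s, ((σ s i : ℤ) : ℝ) * c i -
        ftplPenalty n c (fun _ => 1 / ((n : ℝ) + 1)) i)) ≤ 2 / √(n + 1) := by
    intro i
    have hci := hc i
    set X : ℝ := 4 * c i ^ 2 * n / (1 / ((n : ℝ) + 1)) with hX
    have hX' : X = 4 * c i ^ 2 * n * (n + 1) := by rw [hX]; field_simp
    have hX8 : 8 ≤ X := by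
      have h1 : 1 ≤ c i ^ 2 := one_le_pow₀ hci
      have h2 : 1 ≤ c i ^ 2 * n := one_le_mul_of_one_le_of_one_le h1 hn1
      rw [hX']
      nlinarith
    have hlog : 1 ≤ Real.log X := by
      rw [Real.le_log_iff_exp_le (by linarith)]
      linarith [Real.exp_one_lt_d9]
    set s : ℝ := √(Real.log X) with hs
    have hs1 : 1 ≤ s := Real.one_le_sqrt.2 hlog
    have hs2 : s ^ 2 = Real.log X := Real.sq_sqrt (by linarith)
    set r : ℝ := √(n : ℝ) with hr
    have hr1 : 1 ≤ r := Real.one_le_sqrt.2 hn1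
    have hr2 : r ^ 2 = n := Real.sq_sqrt (by linarith)
    have hB : ftplPenalty n c (fun _ => 1 / ((n : ℝ) + 1)) i = 5 * c i * (r * s) := by
      rw [ftplPenalty, Real.sqrt_mul (by linarith)]
    refine ⟨s / (4 * c i * r), by positivity, ?_⟩
    have hexp : ∀ σ : Playout n (n + 1), Real.exp (s / (4 * c i * r) *
        (4 * ∑ s, ((σ s i : ℤ) : ℝ) * c i - ftplPenalty n c (fun _ => 1 / ((n : ℝ) + 1)) i)) =
        Real.exp (s / r * ∑ s, ((σ s i : ℤ) : ℝ)) * Real.exp (-(5 / 4 * s ^ 2)) := by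
      intro σ
      rw [← Real.exp_add, hB, ← Finset.sum_mul]
      congr 1
      field_simp
      ring
    simp only [hexp]
    rw [← Finset.mul_sum, ← Finset.sum_mul]
    have hmgf := avg_exp_playout_le (n := n) i (s / r)
    have he : (n : ℝ) * ((s / r) ^ 2 / 2) = s ^ 2 / 2 := by
      rw [← hr2]
      field_simp
    rw [he] at hmgf
    have hsqrtX : √X = 2 * c i * r * √(n + 1) := by
      rw [Real.sqrt_eq_iff_mul_self_eq (by linarith) (by positivity), hX']
      have := Real.sq_sqrt (show (0 : ℝ) ≤ n + 1 by linarith)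
      linear_combination -(4 * c i ^ 2 * r ^ 2) * this - (4 * c i ^ 2 * ((n : ℝ) + 1)) * hr2
    have hfin : Real.exp (s ^ 2 / 2) * Real.exp (-(5 / 4 * s ^ 2)) ≤ (√X)⁻¹ := by
      rw [← Real.exp_add, Real.sqrt_eq_rpow, Real.rpow_def_of_pos (by linarith), ← hs2,
        ← Real.exp_neg]
      exact Real.exp_le_exp.2 (by nlinarith [sq_nonneg s])
    calc _ = (s / (4 * c i * r))⁻¹ * (((Fintype.card (Playout n (n + 1)) : ℝ)⁻¹ *
          ∑ σ : Playout n (n + 1), Real.exp (s / r * ∑ s, ((σ s i : ℤ) : ℝ))) *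
            Real.exp (-(5 / 4 * s ^ 2))) := by ring
      _ ≤ (4 * c i * r) * (√X)⁻¹ := by
        refine mul_le_mul ?_ ((mul_le_mul_of_nonneg_right hmgf (Real.exp_pos _).le).trans hfin)
          (by positivity) (by positivity)
        rw [inv_div]
        exact div_le_self (by positivity) hs1
      _ = 2 / √(n + 1) := by
        rw [hsqrtX]
        have : √((n : ℝ) + 1) ≠ 0 := by positivity
        field_simp
        ring
  choose α hα hαle using hterm
  have hpt : ∀ y : Fin (n + 1) → ℝ, ⨆ i, y i ≤ ∑ i, (α i)⁻¹ * Real.exp (α i * y i) := by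
    refine fun y => ciSup_le fun i => ?_
    refine le_trans ?_ (Finset.single_le_sum (f := fun i => (α i)⁻¹ * Real.exp (α i * y i))
      (fun j _ => mul_nonneg (inv_nonneg.2 (hα j).le) (Real.exp_pos _).le) (Finset.mem_univ i))
    rw [← div_eq_inv_mul, le_div_iff₀ (hα i)]
    linarith [Real.add_one_le_exp (α i * y i)]
  calc _ ≤ (Fintype.card (Playout n (n + 1)) : ℝ)⁻¹ *
      ∑ σ : Playout n (n + 1), ∑ i, (α i)⁻¹ * Real.exp (α i * (4 * ∑ s, ((σ s i : ℤ) : ℝ) * c i -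
        ftplPenalty n c (fun _ => 1 / ((n : ℝ) + 1)) i)) :=
      mul_le_mul_of_nonneg_left (Finset.sum_le_sum fun σ _ => hpt _) (by positivity)
    _ ≤ ∑ i : Fin (n + 1), 2 / √(n + 1) := by
      rw [Finset.sum_comm, Finset.mul_sum]
      exact Finset.sum_le_sum fun i _ => hαle i
    _ = 2 * √(n + 1) := by
      rw [Finset.sum_const, Finset.card_univ, Fintype.card_fin, nsmul_eq_mul]
      have h0 : √((n : ℝ) + 1) ≠ 0 := by positivity
      have := Real.sq_sqrt (show (0 : ℝ) ≤ n + 1 by linarith)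
      push_cast
      field_simp
      linear_combination -this
    _ ≤ 4 * √n := by
      have : √((n : ℝ) + 1) ≤ √(2 ^ 2 * n) := Real.sqrt_le_sqrt (by linarith)
      rw [Real.sqrt_mul (by norm_num), Real.sqrt_sq (by norm_num)] at this
      linarith

end Experts

/-! ### The regret of the parameter-free algorithm -/

section ParameterFree

/-- Some scale `e ^ i` exceeds the norm `r` of the comparator by at most a constant factor, unless
`r` is beyond all scales. -/
theorem exists_scale (n : ℕ) {r : ℝ} (hr : 0 ≤ r) :
    ∃ i : Fin (n + 1), Real.exp (i : ℕ) ≤ 3 * (r + 1) ∧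
      (r ≤ Real.exp (i : ℕ) ∨ (n : ℝ) ≤ Real.log (r + 1)) := by
  have hlog : 0 ≤ Real.log (r + 1) := Real.log_nonneg (by linarith)
  have hexp : Real.exp (Real.log (r + 1)) = r + 1 := Real.exp_log (by linarith)
  rcases le_or_gt ⌈Real.log (r + 1)⌉₊ n with h | h
  · refine ⟨⟨⌈Real.log (r + 1)⌉₊, by omega⟩, ?_, Or.inl ?_⟩
    · have h1 := Real.exp_le_exp.2 (Nat.ceil_lt_add_one hlog).le
      rw [Real.exp_add, hexp] at h1
      refine h1.trans ?_
      nlinarith [Real.exp_one_lt_d9]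
    · have h1 := Real.exp_le_exp.2 (Nat.le_ceil (Real.log (r + 1)))
      rw [hexp] at h1
      exact le_trans (by linarith) h1
  · have h1 := (Nat.lt_ceil.1 h).le
    refine ⟨Fin.last n, ?_, Or.inr h1⟩
    have h2 := Real.exp_le_exp.2 h1
    rw [hexp] at h2
    rw [Fin.val_last]
    linarith

variable {E : Type*} [NormedAddCommGroup E]

theorem sqrt_div_le_of_two_le {n : ℕ} (hn : 2 ≤ n) {lam L r : ℝ} (hlam : 0 < lam) (hL : 1 ≤ L)
    (hr : 0 ≤ r) :
    √(n / lam) ≤ 2 * √(n * Real.log ((r + 1) * L * n) / lam) := by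
  have hn2 : (2 : ℝ) ≤ n := by exact_mod_cast hn
  have hY : 2 ≤ (r + 1) * L * n := by
    have : 1 ≤ (r + 1) * L := one_le_mul_of_one_le_of_one_le (by linarith) hL
    nlinarith
  have hlog : 1 / 4 ≤ Real.log ((r + 1) * L * n) := by
    linarith [Real.log_two_gt_d9, Real.log_le_log (by norm_num) hY]
  have h4 : √(2 ^ 2 * (n * Real.log ((r + 1) * L * n) / lam)) =
      2 * √(n * Real.log ((r + 1) * L * n) / lam) := by
    rw [Real.sqrt_mul (by norm_num), Real.sqrt_sq (by norm_num)]
  rw [← h4]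
  refine Real.sqrt_le_sqrt ?_
  rw [← mul_div_assoc]
  refine div_le_div_of_nonneg_right ?_ hlam.le
  nlinarith

/-- At comparators beyond the largest scale, the logarithm in `oracleRate` is at least `n`. -/
theorem le_sqrt_of_le_log {n : ℕ} (hn : 2 ≤ n) {lam L r : ℝ} (hlam : 0 < lam) (hlam1 : lam ≤ 1)
    (hL : 1 ≤ L) (hr : 0 ≤ r) (h : (n : ℝ) ≤ Real.log (r + 1)) :
    (n : ℝ) ≤ √(n * Real.log ((r + 1) * L * n) / lam) := by
  have hn2 : (2 : ℝ) ≤ n := by exact_mod_cast hn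
  refine Real.le_sqrt_of_sq_le ?_
  have h1 : Real.log (r + 1) ≤ Real.log ((r + 1) * L * n) := by
    refine Real.log_le_log (by linarith) ?_
    have : 1 ≤ L * n := one_le_mul_of_one_le_of_one_le hL (by linarith)
    nlinarith
  rw [le_div_iff₀ hlam]
  have h2 : (n : ℝ) * n ≤ n * Real.log ((r + 1) * L * n) :=
    mul_le_mul_of_nonneg_left (h.trans h1) (by linarith)
  nlinarith [sq_nonneg (n : ℝ)]

/-- The penalty of an expert at the scale of the comparator is of the order of `oracleRate`:
inside the logarithm, `4 c² n (n + 1) ≤ 72 Y² ≤ Y ^ 9` for `Y = (‖u‖ + 1) L n ≥ 2`. -/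
theorem ftplPenalty_le_oracleRate {n : ℕ} (hn : 2 ≤ n) {lam L : ℝ} (hlam : 0 < lam)
    (hlam1 : lam ≤ 1) (hL : 1 ≤ L) (u : E) {i : Fin (n + 1)}
    (hi : Real.exp (i : ℕ) ≤ 3 * (‖u‖ + 1)) :
    ftplPenalty n (fun i : Fin (n + 1) => Real.exp (i : ℕ) * L) (fun _ => 1 / ((n : ℝ) + 1)) i ≤
      45 * oracleRate n lam L u := by
  have hn2 : (2 : ℝ) ≤ n := by exact_mod_cast hn
  have hr := norm_nonneg u
  rw [ftplPenalty, oracleRate]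
  set Y : ℝ := (‖u‖ + 1) * L * n with hYdef
  set d : ℝ := Real.exp (i : ℕ) * L with hd
  have hd0 : 0 < d := by positivity
  have hY : 2 ≤ Y := by
    have : 1 ≤ (‖u‖ + 1) * L := one_le_mul_of_one_le_of_one_le (by linarith) hL
    rw [hYdef]
    nlinarith
  have hlogY : 0 ≤ Real.log Y := Real.log_nonneg (by linarith)
  have hdle : d ≤ 3 * (‖u‖ + 1) * L := mul_le_mul_of_nonneg_right hi (by linarith)
  have hX : 4 * d ^ 2 * n / (1 / ((n : ℝ) + 1)) ≤ Y ^ 9 := by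
    have h1 : d ^ 2 ≤ (3 * (‖u‖ + 1) * L) ^ 2 := pow_le_pow_left₀ hd0.le hdle 2
    have h2 : (2 : ℝ) ^ 7 ≤ Y ^ 7 := pow_le_pow_left₀ (by norm_num) hY 7
    have h3 : (n : ℝ) * (n + 1) ≤ 2 * n ^ 2 := by nlinarith
    calc 4 * d ^ 2 * n / (1 / ((n : ℝ) + 1)) = 4 * (d ^ 2 * (n * (n + 1))) := by
          field_simp
      _ ≤ 4 * ((3 * (‖u‖ + 1) * L) ^ 2 * (2 * n ^ 2)) := by gcongr
      _ = 72 * Y ^ 2 := by rw [hYdef]; ring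
      _ ≤ Y ^ 7 * Y ^ 2 := mul_le_mul_of_nonneg_right (by linarith) (sq_nonneg _)
      _ = Y ^ 9 := by ring
  have hlog : Real.log (4 * d ^ 2 * n / (1 / ((n : ℝ) + 1))) ≤ 9 * Real.log Y := by
    have h := Real.log_le_log (by positivity) hX
    rwa [Real.log_pow] at h
  have hsqrt : √(n * Real.log (4 * d ^ 2 * n / (1 / ((n : ℝ) + 1)))) ≤
      3 * √(n * Real.log Y / lam) := by
    have h9 : √(3 ^ 2 * (n * Real.log Y / lam)) = 3 * √(n * Real.log Y / lam) := by
      rw [Real.sqrt_mul (by norm_num), Real.sqrt_sq (by norm_num)]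
    rw [← h9]
    refine Real.sqrt_le_sqrt ?_
    have h1 : (n : ℝ) * Real.log Y ≤ n * Real.log Y / lam :=
      le_div_self (by positivity) hlam hlam1
    nlinarith
  calc 5 * d * √(n * Real.log (4 * d ^ 2 * n / (1 / ((n : ℝ) + 1))))
      ≤ 5 * (3 * (‖u‖ + 1) * L) * (3 * √(n * Real.log Y / lam)) := by gcongr
    _ = 45 * (L * (‖u‖ + 1) * √(n * Real.log Y / lam)) := by ring

theorem oracleRate_nonneg {n : ℕ} {lam L : ℝ} (hL : 0 ≤ L) (u : E) :
    0 ≤ oracleRate n lam L u := by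
  rw [oracleRate]
  positivity

/-- The regret bound for a single round, in which the learner plays the origin. The logarithm may
be small here; `z / (1 + z) ≤ log (1 + z)` suffices. -/
theorem mul_norm_le_oracleRate_one {lam L : ℝ} (hlam : 0 < lam) (hlam1 : lam ≤ 1) (hL : 1 ≤ L)
    (u : E) : L * ‖u‖ ≤ oracleRate 1 lam L u := by
  have hr := norm_nonneg u
  rw [oracleRate, mul_assoc]
  refine mul_le_mul_of_nonneg_left ?_ (by linarith)
  have hz1 : ‖u‖ / (‖u‖ + 1) ≤ 1 := (div_le_one (by linarith)).2 (by linarith)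
  have hz0 : 0 ≤ ‖u‖ / (‖u‖ + 1) := by positivity
  have hlog : ‖u‖ / (‖u‖ + 1) ≤ Real.log ((‖u‖ + 1) * L) := by
    have h1 := Real.one_sub_inv_le_log_of_pos (show 0 < ‖u‖ + 1 by linarith)
    have h2 : 1 - (‖u‖ + 1)⁻¹ = ‖u‖ / (‖u‖ + 1) := by field_simp; ring
    rw [h2] at h1
    exact h1.trans (Real.log_le_log (by linarith) (le_mul_of_one_le_right (by linarith) hL))
  have hsqrt : ‖u‖ / (‖u‖ + 1) ≤
      √((1 : ℕ) * Real.log ((‖u‖ + 1) * L * (1 : ℕ)) / lam) := by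
    refine Real.le_sqrt_of_sq_le ?_
    rw [Nat.cast_one, one_mul, mul_one]
    refine le_trans ?_ (le_div_self (hz0.trans hlog) hlam hlam1)
    nlinarith
  calc ‖u‖ = (‖u‖ + 1) * (‖u‖ / (‖u‖ + 1)) := by field_simp
    _ ≤ _ := mul_le_mul_of_nonneg_left hsqrt (by linarith)

variable [NormedSpace ℝ E]

/-- Mirror Descent at the scale of the comparator attains `oracleRate`; comparators beyond all
scales are covered by the Lipschitz bound. -/
theorem IsMirrorDescent.regret_le_oracleRate {n : ℕ} (hn : 2 ≤ n) {lam R : ℝ} {L : ℝ≥0}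
    (hlam : 0 < lam) (hlam1 : lam ≤ 1) (hE : IsTwoUniformlyConvex E lam) (hL : 1 ≤ L)
    {ℛ : E → ℝ} (hℛ : ℛ = (fun w => ‖w‖ ^ 2 / 2) ∨ ℛ = (fun w => ‖w‖ ^ 2))
    {h : Fin n → E → ℝ} {w : Fin n → E} (hR : 0 < R)
    (hw : IsMirrorDescent (R / L * √(lam / n)) {w : E | ‖w‖ ≤ R} ℛ h w)
    (hlip : ∀ t, LipschitzWith L (h t)) (u : E) (hRu : R ≤ 3 * (‖u‖ + 1))
    (hu : ‖u‖ ≤ R ∨ (n : ℝ) ≤ Real.log (‖u‖ + 1)) :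
    ∑ t, h t (w t) - ∑ t, h t u ≤ 12 * oracleRate n lam L u := by
  have hL1 : (1 : ℝ) ≤ L := by exact_mod_cast hL
  have hr := norm_nonneg u
  rw [oracleRate]
  set Q : ℝ := √(n * Real.log ((‖u‖ + 1) * L * n) / lam) with hQ
  rcases hu with hu | hu
  · have h1 := hw.regret_ball_le hR hL (by omega) hlam hE hℛ hlip hu
    have h2 : √(n / lam) ≤ 2 * Q := sqrt_div_le_of_two_le hn hlam hL1 hr
    calc _ ≤ 2 * (R * L * √(n / lam)) := h1
      _ ≤ 2 * (3 * (‖u‖ + 1) * L * (2 * Q)) := by gcongr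
      _ = _ := by ring
  · have h1 : (n : ℝ) ≤ Q := le_sqrt_of_le_log hn hlam hlam1 hL1 hr hu
    have h2 : ∀ t, h t (w t) - h t u ≤ L * (4 * (‖u‖ + 1)) := by
      intro t
      have h3 := (hlip t).dist_le_mul (w t) u
      rw [Real.dist_eq, dist_eq_norm] at h3
      have h4 : ‖w t‖ ≤ R := hw.mem t
      have h5 : ‖w t - u‖ ≤ 4 * (‖u‖ + 1) := (norm_sub_le _ _).trans (by linarith)
      exact (le_abs_self _).trans (h3.trans (mul_le_mul_of_nonneg_left h5 L.2))
    rw [← Finset.sum_sub_distrib]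
    calc _ ≤ ∑ _t : Fin n, (L : ℝ) * (4 * (‖u‖ + 1)) := Finset.sum_le_sum fun t _ => h2 t
      _ = L * (4 * (‖u‖ + 1)) * n := by simp [mul_comm]
      _ ≤ L * (4 * (‖u‖ + 1)) * Q := by gcongr
      _ ≤ 12 * (L * (‖u‖ + 1) * Q) := by
        have : 0 ≤ L * (‖u‖ + 1) * Q := by positivity
        linarith

/-- With the comparator chosen after the draws, the expected excess over the rate is at most `0`. -/
theorem expect_regret_sub_oracleRate_le {lam : ℝ} (hlam : 0 < lam)
    (hE : IsTwoUniformlyConvex E lam) {ℛ : E → ℝ}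
    (hℛ : ℛ = (fun w => ‖w‖ ^ 2 / 2) ∨ ℛ = (fun w => ‖w‖ ^ 2)) {L : ℝ≥0} (hL : 1 ≤ L) {n : ℕ}
    (hn : 1 ≤ n) {f : Fin n → Outcome n (n + 1) → E → ℝ} (hf : IsPredictable f)
    (hlip : ∀ t ω, LipschitzWith L (f t ω))
    {x : Fin (n + 1) → Fin n → Outcome n (n + 1) → E}
    {p : Fin n → Outcome n (n + 1) → Fin (n + 1) → ℝ}
    (hrun : IsParameterFreeRun lam L ℛ f x p) (u : Outcome n (n + 1) → E) :
    expect p (fun ω => regret f x ω (u ω) - 65 * oracleRate n lam L (u ω)) ≤ 0 := by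
  have hL1 : (1 : ℝ) ≤ L := by exact_mod_cast hL
  have had := hrun.ftpl.adapted
  have hp := hrun.ftpl.mem_simplex
  suffices h : ∃ Ψ : Outcome n (n + 1) → ℝ, expect p Ψ ≤ 0 ∧
      ∀ ω, regret f x ω (u ω) - 65 * oracleRate n lam L (u ω) ≤ Ψ ω by
    obtain ⟨Ψ, hΨ, hle⟩ := h
    exact (expect_mono hp hle).trans hΨ
  rcases subsingleton_or_nontrivial E with hsub | hnt
  · -- all points coincide, and `lam` is not bounded by `1`
    refine ⟨fun _ => 0, (expect_const had hp 0).le, fun ω => ?_⟩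
    have : regret f x ω (u ω) = 0 := by
      rw [regret, Finset.sum_congr rfl fun t _ => by
        rw [Subsingleton.elim (x (ω t).2 t ω) (u ω)], sub_self]
    change _ ≤ (0 : ℝ)
    linarith [oracleRate_nonneg (n := n) (lam := lam) L.coe_nonneg (u ω)]
  have hlam1 := hE.le_one
  rcases Nat.lt_or_ge n 2 with hn2 | hn2
  · obtain rfl : n = 1 := by omega
    refine ⟨fun _ => 0, (expect_const had hp 0).le, fun ω => ?_⟩
    have h0 : ∀ i t, x i t ω = 0 := fun i t =>
      (hrun.sub i ω).first_eq_zero (Real.exp_pos _) hℛ (by omega)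
    have h1 := (hlip 0 ω).dist_le_mul 0 (u ω)
    rw [Real.dist_eq, dist_eq_norm, zero_sub, norm_neg] at h1
    have h2 := mul_norm_le_oracleRate_one hlam hlam1 hL1 (u ω)
    have h3 := oracleRate_nonneg (n := 1) (lam := lam) L.coe_nonneg (u ω)
    have h4 : regret f x ω (u ω) = f 0 ω 0 - f 0 ω (u ω) := by
      simp [regret, h0]
    change _ ≤ (0 : ℝ)
    linarith [(abs_le.1 h1).2]
  set c : Fin (n + 1) → ℝ := fun i => Real.exp (i : ℕ) * L with hc
  have hc1 : ∀ i, 1 ≤ c i := fun i =>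
    one_le_mul_of_one_le_of_one_le (Real.one_le_exp (Nat.cast_nonneg _)) hL1
  set g : Fin n → Outcome n (n + 1) → Fin (n + 1) → ℝ :=
    fun t ω i => f t ω (x i t ω) - f t ω 0 with hg
  have hgpred : IsPredictable g := fun t ω ω' h => by
    funext i
    simp only [hg]
    rw [hf t ω ω' h, hrun.predictable i t ω ω' h]
  have hgc : ∀ t ω i, |g t ω i| ≤ c i := fun t ω i => by
    have h1 := (hlip t ω).dist_le_mul (x i t ω) 0
    rw [Real.dist_eq, dist_zero_right] at h1
    have h2 : ‖x i t ω‖ ≤ Real.exp (i : ℕ) := (hrun.sub i ω).mem t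
    refine h1.trans ?_
    rw [hc, mul_comm]
    exact mul_le_mul_of_nonneg_right h2 L.2
  have hexp := (expect_ftpl_regret_le (fun i => by linarith [hc1 i]) hrun.ftpl hgpred hgc).trans
    (avg_iSup_signs_sub_penalty_le hn hc1)
  refine ⟨fun ω => (∑ t, g t ω (ω t).2 + ⨆ i, (-(∑ t, g t ω i) -
    ftplPenalty n c (fun _ => 1 / ((n : ℝ) + 1)) i)) - 4 * √n, ?_, fun ω => ?_⟩
  · rw [expect_sub, expect_const had hp]
    linarith
  obtain ⟨i, hi, hiu⟩ := exists_scale n (norm_nonneg (u ω))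
  have hmd := (hrun.sub i ω).regret_le_oracleRate hn2 hlam hlam1 hE hL hℛ (Real.exp_pos _)
    (fun t => LipschitzWith.of_dist_le_mul fun a b => by
      rw [dist_sub_right]
      exact (hlip t ω).dist_le_mul a b) (u ω) hi hiu
  have hpen := ftplPenalty_le_oracleRate hn2 hlam hlam1 hL1 (u ω) hi
  have hsup := le_ciSup (f := fun i => -(∑ t, g t ω i) -
    ftplPenalty n c (fun _ => 1 / ((n : ℝ) + 1)) i) (Set.finite_range _).bddAbove i
  have htail : 4 * √n ≤ 8 * oracleRate n lam L (u ω) := by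
    have h1 : √n ≤ √(n / lam) := Real.sqrt_le_sqrt (le_div_self (Nat.cast_nonneg n) hlam hlam1)
    have h2 := sqrt_div_le_of_two_le hn2 hlam hL1 (norm_nonneg (u ω))
    have h3 : 1 ≤ L * (‖u ω‖ + 1) :=
      one_le_mul_of_one_le_of_one_le hL1 (by linarith [norm_nonneg (u ω)])
    rw [oracleRate]
    have h4 := le_mul_of_one_le_left
      (Real.sqrt_nonneg (n * Real.log ((‖u ω‖ + 1) * L * n) / lam)) h3
    linarith
  simp only [regret, hg, Finset.sum_sub_distrib] at hmd hsup ⊢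
  linarith

end ParameterFree

end

theorem theorem3 :
    ∃ C : ℝ, 0 < C ∧
      ∀ (E : Type*) [NormedAddCommGroup E] [NormedSpace ℝ E] [CompleteSpace E]
        (lam : ℝ), 0 < lam → IsTwoUniformlyConvex E lam →
      ∀ (ℛ : E → ℝ), (ℛ = (fun w => ‖w‖ ^ 2 / 2) ∨ ℛ = (fun w => ‖w‖ ^ 2)) →
      ∀ (L : ℝ≥0), 1 ≤ L → ∀ (n : ℕ), 1 ≤ n →
      ∀ (f : Fin n → Outcome n (n + 1) → E → ℝ), IsPredictable f →
        (∀ t ω, ConvexOn ℝ Set.univ (f t ω)) → (∀ t ω, LipschitzWith L (f t ω)) →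
      ∀ (x : Fin (n + 1) → Fin n → Outcome n (n + 1) → E)
        (p : Fin n → Outcome n (n + 1) → Fin (n + 1) → ℝ),
        IsParameterFreeRun lam L ℛ f x p →
        (∀ w : E, expect p (fun ω => regret f x ω w) ≤ C * oracleRate n lam L w) ∧
        (∀ u : Outcome n (n + 1) → E,
          expect p (fun ω => regret f x ω (u ω) - C * oracleRate n lam L (u ω)) ≤ 0) := by
  refine ⟨65, by norm_num, ?_⟩
  intro E _ _ _ lam hlam hE ℛ hℛ L hL n hn f hf _ hlip x p hrun
  have key := expect_regret_sub_oracleRate_le hlam hE hℛ hL hn hf hlip hrun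
  refine ⟨fun w => ?_, key⟩
  have h := key fun _ => w
  rw [expect_sub, expect_const hrun.ftpl.adapted hrun.ftpl.mem_simplex] at h
  linarith
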